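/- All tournaments are finite. The chromatic number $\chi(G)$ of a tournament $G$ is the minimum $k$ such that $V(G)$ is the union of $k$ sets each inducing an acyclic subtournament, and $\chi(A)=\chi(G[A])$ for $A\subseteq V(G)$. For disjoint $A,B\subseteq V(G)$, write $A\Rightarrow B$ if no edge goes from $B$ to $A$. A tournament is $H$-free if no subtournament of it is isomorphic to $H$. A class $\mathcal{C}$ of tournaments is hereditary if every tournament isomorphic to a subtournament of a member of $\mathcal{C}$ is in $\mathcal{C}$. A tournament $H$ is a hero relative to $\mathcal{C}$ if there is $c\ge 0$ such that every $H$-free tournament in $\mathcal{C}$ has chromatic number less than $c$. Let $\Delta(H_1,H_2,1)$ be the tournament whose vertex set is the disjoint union of sets $A_1,A_2,A_3$, where $A_1,A_2$ induce tournaments isomorphic to $H_1,H_2$ respectively, $|A_3|=1$, and $A_1\Rightarrow A_2\Rightarrow A_3\Rightarrow A_1$. A diamond in a tournament $G$ is a quadruple $(a,b,P,Q)$ with $a,b\in V(G)$ distinct and $P,Q$ disjoint subsets of $V(G)\setminus\{a,b\}$ such that $\{a\}\Rightarrow P\Rightarrow \{b\}\Rightarrow Q\Rightarrow \{a\}$;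 its chromatic number is $\min(\chi(P),\chi(Q))$. The local chromatic number of a numbering $v_1,\ldots,v_n$ of $V(G)$ is the maximum over $1\le i\le n$ of the chromatic number of the set of all $v_j$ such that either $j>i$ and the edge between $v_i,v_j$ goes from $v_j$ to $v_i$, or $j<i$ and this edge goes from $v_i$ to $v_j$ (and it is $0$ if $n=0$). Theorem. Let $\mathcal{C}$ be a hereditary class of tournaments, and let $H_1,H_2$ be heroes relative to $\mathcal{C}$. Then there exists $d$ such that for every $\Delta(H_1,H_2,1)$-free tournament $G\in\mathcal{C}$, every diamond in $G$ has chromatic number at most $d$. Consequently, there exists $c$ such that every $\Delta(H_1,H_2,1)$-free member of $\mathcal{C}$ admits a numbering with local chromatic number at most $c$. -/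

import Mathlib

universe u

/-- A (finite) tournament: a finite loopless digraph in which every two distinct vertices are
joined by an edge in exactly one of the two directions.
`G.Adj x y` means that there is an edge from `x` to `y`. -/
structure Tournament : Type (u + 1) where
  V : Type u
  finite : Finite V
  Adj : V → V → Prop
  loopless : ∀ x, ¬ Adj x x
  asymm : ∀ x y, Adj x y → ¬ Adj y x
  total : ∀ x y, x ≠ y → Adj x y ∨ Adj y x

namespace Tournament

/-- The subtournament `G[A]` induced on a set `A` of vertices. -/
def induce (G : Tournament.{u}) (A : Set G.V) : Tournament.{u} where
  V := A
  finite := haveI := G.finite; inferInstance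
  Adj x y := G.Adj x y
  loopless x := G.loopless x
  asymm x y := G.asymm x y
  total x y h := G.total x y (fun e => h (Subtype.ext e))

/-- No directed cycle: no vertex is reachable from itself along a nonempty directed walk. -/
def IsAcyclic (G : Tournament.{u}) : Prop :=
  ∀ x : G.V, ¬ Relation.TransGen G.Adj x x

/-- `V(G)` is the union of `k` sets, each inducing an acyclic subtournament. -/
def Colourable (G : Tournament.{u}) (k : ℕ) : Prop :=
  ∃ A : Fin k → Set G.V, (∀ i, (G.induce (A i)).IsAcyclic) ∧ (⋃ i, A i) = Set.univ

/-- The minimum below is over a nonempty set of numbers. -/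
theorem exists_colourable (G : Tournament.{u}) : ∃ k, G.Colourable k := by
  haveI := G.finite
  obtain ⟨n, ⟨e⟩⟩ := Finite.exists_equiv_fin G.V
  refine ⟨n, fun i => {e.symm i}, fun i x hx => ?_, ?_⟩
  · obtain ⟨y, hy, -⟩ := Relation.TransGen.head'_iff.mp hx
    have h : x = y := Subtype.ext (x.2.trans y.2.symm)
    exact (G.induce _).loopless x (h ▸ hy)
  · ext x
    simp only [Set.mem_iUnion, Set.mem_singleton_iff, Set.mem_univ, iff_true]
    exact ⟨e x, by simp⟩

/-- The chromatic number `χ(G)` of a tournament. -/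
noncomputable def chi (G : Tournament.{u}) : ℕ := sInf {k | G.Colourable k}

/-- The chromatic number `χ(A) = χ(G[A])` of a set of vertices of `G`. -/
noncomputable def chiOn (G : Tournament.{u}) (A : Set G.V) : ℕ := (G.induce A).chi

/-- `A ⇒ B`: the sets are disjoint and there is no edge with tail in `B` and head in `A`. -/
def Complete (G : Tournament.{u}) (A B : Set G.V) : Prop :=
  Disjoint A B ∧ ∀ x ∈ B, ∀ y ∈ A, ¬ G.Adj x y

/-- `G` and `H` are isomorphic. -/
def IsIso (G H : Tournament.{u}) : Prop := Nonempty (G.Adj ≃r H.Adj)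

/-- `G` contains `H`: some subtournament of `G` is isomorphic to `H`. -/
def Contains (G H : Tournament.{u}) : Prop := ∃ A : Set G.V, (G.induce A).IsIso H

/-- `G` is `H`-free. -/
def Free (G H : Tournament.{u}) : Prop := ¬ G.Contains H

/-- The one-vertex tournament. -/
def one : Tournament.{u} where
  V := PUnit
  finite := inferInstance
  Adj _ _ := False
  loopless _ := id
  asymm _ _ h := h.elim
  total _ _ h := (h rfl).elim

/-- The edges of `Δ(H₁, H₂, H₃)`: those inside the three parts, and all edges from the first part
to the second, from the second to the third and from the third to the first. -/
def deltaAdj (H₁ H₂ H₃ : Tournament.{u}) :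
    H₁.V ⊕ H₂.V ⊕ H₃.V → H₁.V ⊕ H₂.V ⊕ H₃.V → Prop
  | .inl x, .inl y => H₁.Adj x y
  | .inr (.inl x), .inr (.inl y) => H₂.Adj x y
  | .inr (.inr x), .inr (.inr y) => H₃.Adj x y
  | .inl _, .inr (.inl _) => True
  | .inr (.inl _), .inr (.inr _) => True
  | .inr (.inr _), .inl _ => True
  | .inr (.inl _), .inl _ => False
  | .inr (.inr _), .inr (.inl _) => False
  | .inl _, .inr (.inr _) => False

/-- The tournament `Δ(H₁, H₂, H₃)`. -/
def delta (H₁ H₂ H₃ : Tournament.{u}) : Tournament.{u} where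
  V := H₁.V ⊕ H₂.V ⊕ H₃.V
  finite := haveI := H₁.finite; haveI := H₂.finite; haveI := H₃.finite; inferInstance
  Adj := deltaAdj H₁ H₂ H₃
  loopless := by
    rintro (x | x | x)
    · exact H₁.loopless x
    · exact H₂.loopless x
    · exact H₃.loopless x
  asymm := by
    rintro (x | x | x) (y | y | y) <;> simp only [deltaAdj] <;>
      first
        | exact H₁.asymm x y
        | exact H₂.asymm x y
        | exact H₃.asymm x y
        | simp
  total := by
    rintro (x | x | x) (y | y | y) h <;> simp only [deltaAdj] <;>
      first
        | exact H₁.total x y (fun e => h (by rw [e]))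
        | exact H₂.total x y (fun e => h (by rw [e]))
        | exact H₃.total x y (fun e => h (by rw [e]))
        | simp

/-- `(a, b, P, Q)` is a diamond in `G`. -/
structure IsDiamond (G : Tournament.{u}) (a b : G.V) (P Q : Set G.V) : Prop where
  ne : a ≠ b
  disjoint : Disjoint P Q
  left_subset : P ⊆ Set.univ \ {a, b}
  right_subset : Q ⊆ Set.univ \ {a, b}
  a_P : G.Complete {a} P
  P_b : G.Complete P {b}
  b_Q : G.Complete {b} Q
  Q_a : G.Complete Q {a}

/-- The chromatic number of a diamond `(a, b, P, Q)`. -/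
noncomputable def diamondChi (G : Tournament.{u}) (_a _b : G.V) (P Q : Set G.V) : ℕ :=
  min (G.chiOn P) (G.chiOn Q)

/-- A numbering of (the vertex set of) `G`: an enumeration of `V(G)` without repetition. -/
abbrev Numbering (G : Tournament.{u}) : Type u := Fin (Nat.card G.V) ≃ G.V

/-- `v j` is a forward in-neighbour of `v i`. -/
def IsForwardInNeighbour (G : Tournament.{u}) (v : G.Numbering) (i j : Fin (Nat.card G.V)) :
    Prop := i < j ∧ G.Adj (v j) (v i)

/-- `v j` is a backward out-neighbour of `v i`. -/
def IsBackwardOutNeighbour (G : Tournament.{u}) (v : G.Numbering) (i j : Fin (Nat.card G.V)) :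
    Prop := G.IsForwardInNeighbour v j i

/-- The local chromatic number of a numbering: the maximum over `i` of the chromatic number of the
set of all backward out-neighbours and forward in-neighbours of `v i` (it is `0` if `G` has no
vertices). -/
noncomputable def localChi (G : Tournament.{u}) (v : G.Numbering) : ℕ :=
  Finset.univ.sup fun i : Fin (Nat.card G.V) =>
    G.chiOn {x | ∃ j, x = v j ∧ (G.IsBackwardOutNeighbour v i j ∨ G.IsForwardInNeighbour v i j)}

/-- A class of tournaments that contains every tournament isomorphic to a subtournament of one of
its members. -/
def IsHereditary (C : Set Tournament.{u}) : Prop :=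
  ∀ G ∈ C, ∀ H : Tournament.{u}, (∃ A : Set G.V, H.IsIso (G.induce A)) → H ∈ C

/-- `H` is a hero relative to the class `C`. -/
def IsHeroRelativeTo (H : Tournament.{u}) (C : Set Tournament.{u}) : Prop :=
  ∃ c : ℕ, ∀ G ∈ C, G.Free H → G.chi < c

end Tournament

namespace Tournament

variable {G H : Tournament.{u}}

/-! Heredity turns the hero hypotheses into one statement about `G`: every vertex set of chromatic
number at least `c` contains copies of `H₁` and `H₂`. Call disjoint sets linked if neither contains
a copy of `H₁` complete to a copy of `H₂` in the other. In a `Δ(H₁, H₂, 1)`-free tournament the two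
sides of a diamond are linked: each apex rules out one direction.

Between linked sets most vertices of one have both out- and in-neighbourhoods of large chromatic
number in the other (`exists_splitting_vertex`). If a linked pair had huge chromatic number,
repeated splitting would produce many pairwise linked sets inside one of them
(`exists_pairwise_linked`). Choosing one splitting vertex from each set in turn realises any
prescribed tournament (`exists_transversal`), in particular `Δ(H₁, H₂, 1)` itself, a contradiction.

For the numbering, let `outDist a b` be `χ(N⁺(b) \ N⁺(a))`, which satisfies a directed triangle
inequality. Bounded diamonds make one of `outDist a b`, `outDist b a` small, so the relation
"`outDist b a` is large" has no cycles and extends to a linear order. In that order the backward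
out-neighbours of a vertex have bounded in-neighbourhoods among themselves, and the forward
in-neighbours bounded out-neighbourhoods. The local-to-global theorem `exists_chiOn_le_of_outN` and
its reversal then bound both sets. That theorem rests on domination: large domination number forces
a small subset of large chromatic number. -/

instance (G : Tournament.{u}) : Finite G.V := G.finite

/-! ### Chromatic number of vertex sets -/

/-- The out-neighbours of a vertex. -/
def outN (G : Tournament.{u}) (v : G.V) : Set G.V := {u | G.Adj v u}

/-- The in-neighbours of a vertex. -/
def inN (G : Tournament.{u}) (v : G.V) : Set G.V := {u | G.Adj u v}

theorem adj_of_not_adj {x y : G.V} (hne : x ≠ y) (h : ¬ G.Adj x y) : G.Adj y x :=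
  (G.total x y hne).resolve_left h

theorem isAcyclic_induce_image {A : Set G.V} {S : Set A}
    (hS : ((G.induce A).induce S).IsAcyclic) :
    (G.induce (Subtype.val '' S : Set G.V)).IsAcyclic := fun x hx => by
  have key : ∀ z : (Subtype.val '' S : Set G.V), ∃ w : S, w.1.1 = z.1 := by
    rintro ⟨z, w, hw, rfl⟩
    exact ⟨⟨w, hw⟩, rfl⟩
  choose f hf using key
  refine hS (f x) (Relation.TransGen.lift (r := (G.induce (Subtype.val '' S : Set G.V)).Adj)
    (p := ((G.induce A).induce S).Adj) f (fun a b h => ?_) _ _ hx)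
  have hab : G.Adj a.1 b.1 := h
  rwa [← hf a, ← hf b] at hab

theorem isAcyclic_induce_preimage {A B : Set G.V} (hB : (G.induce B).IsAcyclic) :
    ((G.induce A).induce (Subtype.val ⁻¹' B : Set A)).IsAcyclic := fun x hx =>
  hB ⟨x.1.1, x.2⟩ (Relation.TransGen.lift
    (r := ((G.induce A).induce (Subtype.val ⁻¹' B : Set A)).Adj) (p := (G.induce B).Adj)
    (fun z : (Subtype.val ⁻¹' B : Set A) => (⟨z.1.1, z.2⟩ : B)) (fun _ _ h => h) _ _ hx)

/-- `A` is covered by `k` sets inducing acyclic subtournaments. -/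
def ColourableOn (G : Tournament.{u}) (A : Set G.V) (k : ℕ) : Prop :=
  ∃ B : Fin k → Set G.V, (∀ i, (G.induce (B i)).IsAcyclic) ∧ A ⊆ ⋃ i, B i

theorem colourable_induce_iff {A : Set G.V} {k : ℕ} :
    (G.induce A).Colourable k ↔ G.ColourableOn A k := by
  constructor
  · rintro ⟨S, hS, hU⟩
    refine ⟨fun i => Subtype.val '' S i, fun i => isAcyclic_induce_image (hS i), fun x hx => ?_⟩
    have : (⟨x, hx⟩ : A) ∈ ⋃ i, S i := hU ▸ Set.mem_univ (α := A) ⟨x, hx⟩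
    obtain ⟨i, hi⟩ := Set.mem_iUnion.1 this
    exact Set.mem_iUnion.2 ⟨i, ⟨x, hx⟩, hi, rfl⟩
  · rintro ⟨B, hB, hA⟩
    refine ⟨fun i => Subtype.val ⁻¹' B i, fun i => isAcyclic_induce_preimage (hB i), ?_⟩
    refine Set.eq_univ_of_forall fun x => ?_
    obtain ⟨i, hi⟩ := Set.mem_iUnion.1 (hA x.2)
    exact Set.mem_iUnion.2 ⟨i, hi⟩

theorem isAcyclic_induce_empty : (G.induce ∅).IsAcyclic := fun x => x.2.elim

theorem ColourableOn.mono {A : Set G.V} {k l : ℕ} (hkl : k ≤ l) (h : G.ColourableOn A k) :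
    G.ColourableOn A l := by
  obtain ⟨B, hB, hA⟩ := h
  refine ⟨fun i => if hi : i.1 < k then B ⟨i, hi⟩ else ∅, fun i => ?_, fun x hx => ?_⟩
  · dsimp only
    split
    · exact hB _
    · exact isAcyclic_induce_empty
  · obtain ⟨i, hi⟩ := Set.mem_iUnion.1 (hA hx)
    exact Set.mem_iUnion.2 ⟨⟨i, i.2.trans_le hkl⟩, by simpa using hi⟩

theorem chiOn_le_iff {A : Set G.V} {k : ℕ} : G.chiOn A ≤ k ↔ G.ColourableOn A k := by
  constructor
  · intro h
    have := Nat.sInf_mem (exists_colourable (G.induce A))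
    exact (colourable_induce_iff.1 this).mono h
  · intro h
    exact Nat.sInf_le (colourable_induce_iff.2 h)

theorem colourableOn_chiOn (A : Set G.V) : G.ColourableOn A (G.chiOn A) := chiOn_le_iff.1 le_rfl

theorem chiOn_mono {A B : Set G.V} (hAB : A ⊆ B) : G.chiOn A ≤ G.chiOn B := by
  obtain ⟨S, hS, hB⟩ := colourableOn_chiOn B
  exact chiOn_le_iff.2 ⟨S, hS, hAB.trans hB⟩

theorem chiOn_union_le (A B : Set G.V) : G.chiOn (A ∪ B) ≤ G.chiOn A + G.chiOn B := by
  obtain ⟨S, hS, hA⟩ := colourableOn_chiOn A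
  obtain ⟨T, hT, hB⟩ := colourableOn_chiOn B
  refine chiOn_le_iff.2 ⟨Fin.append S T, fun i => ?_, ?_⟩
  · refine Fin.addCases (fun i => ?_) (fun i => ?_) i
    · rw [Fin.append_left]; exact hS i
    · rw [Fin.append_right]; exact hT i
  · rintro x (hx | hx)
    · obtain ⟨i, hi⟩ := Set.mem_iUnion.1 (hA hx)
      exact Set.mem_iUnion.2 ⟨Fin.castAdd _ i, by rwa [Fin.append_left]⟩
    · obtain ⟨i, hi⟩ := Set.mem_iUnion.1 (hB hx)
      exact Set.mem_iUnion.2 ⟨Fin.natAdd _ i, by rwa [Fin.append_right]⟩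

theorem chiOn_empty : G.chiOn ∅ = 0 :=
  Nat.le_zero.1 (chiOn_le_iff.2 ⟨fun _ => ∅, fun i => i.elim0, Set.empty_subset _⟩)

theorem chiOn_singleton_le (v : G.V) : G.chiOn {v} ≤ 1 := by
  refine chiOn_le_iff.2 ⟨fun _ => {v}, fun _ x hx => ?_, fun x hx => Set.mem_iUnion.2 ⟨0, hx⟩⟩
  obtain ⟨y, hy, -⟩ := Relation.TransGen.head'_iff.mp hx
  have h : x = y := Subtype.ext (x.2.trans y.2.symm)
  exact (G.induce _).loopless x (h ▸ hy)

theorem nonempty_of_chiOn_pos {A : Set G.V} (h : 0 < G.chiOn A) : A.Nonempty := by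
  rw [Set.nonempty_iff_ne_empty]
  rintro rfl
  simp [chiOn_empty] at h

theorem chiOn_pos_of_nonempty {A : Set G.V} (h : A.Nonempty) : 0 < G.chiOn A := by
  by_contra h0
  obtain ⟨B, -, hB⟩ := chiOn_le_iff.1 (Nat.le_zero.2 (Nat.eq_zero_of_not_pos h0))
  obtain ⟨x, hx⟩ := h
  obtain ⟨i, -⟩ := Set.mem_iUnion.1 (hB hx)
  exact i.elim0

theorem chiOn_biUnion_finset_le {ι : Type*} (s : Finset ι) (f : ι → Set G.V) (t : ℕ)
    (h : ∀ i ∈ s, G.chiOn (f i) ≤ t) : G.chiOn (⋃ i ∈ s, f i) ≤ s.card * t := by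
  classical
  induction s using Finset.induction_on with
  | empty => simp [chiOn_empty]
  | insert a s ha ih =>
    rw [Finset.set_biUnion_insert, Finset.card_insert_of_notMem ha, add_mul, one_mul, add_comm]
    exact (chiOn_union_le _ _).trans (add_le_add (h a (Finset.mem_insert_self _ _))
      (ih fun i hi => h i (Finset.mem_insert_of_mem hi)))

theorem chiOn_iUnion_le {ι : Type*} [Finite ι] (f : ι → Set G.V) (t : ℕ)
    (h : ∀ i, G.chiOn (f i) ≤ t) : G.chiOn (⋃ i, f i) ≤ Nat.card ι * t := by
  have := Fintype.ofFinite ι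
  simpa [Nat.card_eq_fintype_card] using
    chiOn_biUnion_finset_le (G := G) Finset.univ f t (fun i _ => h i)

theorem chiOn_le_add_diff (A B : Set G.V) : G.chiOn A ≤ G.chiOn B + G.chiOn (A \ B) :=
  (chiOn_mono (by rw [Set.union_sdiff_self]; exact Set.subset_union_right)).trans
    (chiOn_union_le B (A \ B))

/-! ### Copies of a tournament -/

/-- `f` embeds `H` into `G`. -/
def IsCopy (G H : Tournament.{u}) (f : H.V → G.V) : Prop :=
  ∀ x y, G.Adj (f x) (f y) ↔ H.Adj x y

theorem IsCopy.injective {f : H.V → G.V} (hf : G.IsCopy H f) : Function.Injective f := by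
  intro x y hxy
  by_contra hne
  rcases H.total x y hne with h | h
  · exact G.loopless _ (hxy ▸ (hf x y).2 h)
  · exact G.loopless _ (hxy ▸ (hf y x).2 h)

theorem IsCopy.contains {f : H.V → G.V} (hf : G.IsCopy H f) : G.Contains H := by
  refine ⟨Set.range f, ⟨RelIso.symm ⟨Equiv.ofInjective f hf.injective, ?_⟩⟩⟩
  intro x y
  exact hf x y

theorem Contains.exists_copy {A : Set G.V} (h : (G.induce A).Contains H) :
    ∃ f, G.IsCopy H f ∧ ∀ x, f x ∈ A := by
  obtain ⟨S, ⟨e⟩⟩ := h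
  refine ⟨fun x => (e.symm x).1.1, fun x y => ?_, fun x => (e.symm x).1.2⟩
  exact e.symm.map_rel_iff

/-- Every vertex set of chromatic number at least `c` contains a copy of `H`. -/
def ForcesCopy (G H : Tournament.{u}) (c : ℕ) : Prop :=
  ∀ A : Set G.V, c ≤ G.chiOn A → ∃ f, G.IsCopy H f ∧ ∀ x, f x ∈ A

/-- The only use of heredity: `G[A]` is again in the class. From here on the class plays no role. -/
theorem IsHereditary.forcesCopy {C : Set Tournament.{u}} (hC : IsHereditary C) {c : ℕ}
    (hc : ∀ G ∈ C, G.Free H → G.chi < c) (hG : G ∈ C) : G.ForcesCopy H c := by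
  intro A hA
  have hmem : G.induce A ∈ C := hC G hG _ ⟨A, ⟨RelIso.refl _⟩⟩
  refine Contains.exists_copy ?_
  by_contra hfree
  exact absurd (hc _ hmem hfree) (not_lt.2 hA)

theorem ForcesCopy.mono {c d : ℕ} (hcd : c ≤ d) (h : G.ForcesCopy H c) : G.ForcesCopy H d :=
  fun A hA => h A (hcd.trans hA)

end Tournament
namespace Tournament

variable {G H : Tournament.{u}}

/-! ### Linked sets -/

/-- No copy of `H₁` in `A` is complete to a copy of `H₂` in `B`. -/
def NoArrow (G H₁ H₂ : Tournament.{u}) (A B : Set G.V) : Prop :=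
  ∀ f g, G.IsCopy H₁ f → G.IsCopy H₂ g → (∀ x, f x ∈ A) → (∀ y, g y ∈ B) →
    ∃ x y, ¬ G.Adj (f x) (g y)

/-- `A` and `B` are disjoint, and no copy of `H₁` in one of them is complete to a copy of `H₂` in
the other. -/
structure Linked (G H₁ H₂ : Tournament.{u}) (A B : Set G.V) : Prop where
  disjoint : Disjoint A B
  left : G.NoArrow H₁ H₂ A B
  right : G.NoArrow H₁ H₂ B A

variable {H₁ H₂ : Tournament.{u}}

theorem NoArrow.mono {A A' B B' : Set G.V} (h : G.NoArrow H₁ H₂ A B) (hA : A' ⊆ A) (hB : B' ⊆ B) :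
    G.NoArrow H₁ H₂ A' B' :=
  fun f g hf hg hfA hgB => h f g hf hg (fun x => hA (hfA x)) (fun y => hB (hgB y))

theorem Linked.mono {A A' B B' : Set G.V} (h : G.Linked H₁ H₂ A B) (hA : A' ⊆ A) (hB : B' ⊆ B) :
    G.Linked H₁ H₂ A' B' :=
  ⟨h.disjoint.mono hA hB, h.left.mono hA hB, h.right.mono hB hA⟩

theorem Linked.symm {A B : Set G.V} (h : G.Linked H₁ H₂ A B) : G.Linked H₁ H₂ B A :=
  ⟨h.disjoint.symm, h.right, h.left⟩

/-- A copy of `H₁` in `A` complete to a copy of `H₂` in `B` would form `Δ(H₁, H₂, 1)` with `v` as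
the third part. -/
theorem Free.noArrow (hfree : G.Free (delta H₁ H₂ one)) (v : G.V) {A B : Set G.V}
    (hA : A ⊆ G.outN v) (hB : B ⊆ G.inN v) : G.NoArrow H₁ H₂ A B := by
  intro f g hf hg hfA hgB
  by_contra! hfg
  refine hfree (IsCopy.contains (f := Sum.elim f (Sum.elim g fun _ => v)) ?_)
  rintro (x | x | x) (y | y | y) <;> simp only [delta, deltaAdj, Sum.elim_inl, Sum.elim_inr]
  · exact hf x y
  · exact iff_of_true (hfg x y) trivial
  · exact iff_of_false (G.asymm _ _ (hA (hfA x))) id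
  · exact iff_of_false (G.asymm _ _ (hfg y x)) id
  · exact hg x y
  · exact iff_of_true (hB (hgB x)) trivial
  · exact iff_of_true (hA (hfA y)) trivial
  · exact iff_of_false (G.asymm _ _ (hB (hgB y))) id
  · exact iff_of_false (G.loopless v) id

theorem disjoint_outN_inN (v : G.V) : Disjoint (G.outN v) (G.inN v) :=
  Set.disjoint_left.2 fun _ h h' => G.asymm _ _ h h'

/-! ### Splitting vertices, transversals and the bound for linked sets -/

variable {c h : ℕ}

/-- Otherwise the exceptional vertices contain a copy of `H₂`, whose out-neighbours use at most `h *
t` colours of `B`. The rest of `B` still contains a copy of `H₁`, and it is complete to that copy of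
`H₂`. -/
theorem chiOn_few_outN_lt (h₁ : G.ForcesCopy H₁ c) (h₂ : G.ForcesCopy H₂ c)
    (hh : Nat.card H₂.V ≤ h) {A B : Set G.V} (hAB : G.Linked H₁ H₂ A B) {t : ℕ}
    (hB : c + h * t ≤ G.chiOn B) : G.chiOn {a ∈ A | G.chiOn (G.outN a ∩ B) < t} < c := by
  by_contra! hbad
  obtain ⟨g, hg, hgA⟩ := h₂ _ hbad
  have hU : G.chiOn (⋃ y, G.outN (g y) ∩ B) ≤ h * t :=
    (chiOn_iUnion_le _ t fun y => (hgA y).2.le).trans (Nat.mul_le_mul_right _ hh)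
  have := chiOn_le_add_diff B (⋃ y, G.outN (g y) ∩ B)
  obtain ⟨f, hf, hfB⟩ := h₁ (B \ ⋃ y, G.outN (g y) ∩ B) (by omega)
  obtain ⟨x, y, hxy⟩ := hAB.right f g hf hg (fun x => (hfB x).1) (fun y => (hgA y).1)
  refine hxy (adj_of_not_adj ?_ fun hadj => (hfB x).2 (Set.mem_iUnion.2 ⟨y, hadj, (hfB x).1⟩))
  exact hAB.disjoint.ne_of_mem (hgA y).1 (hfB x).1

/-- The mirror image: the exceptional set supplies `H₁`, and `B` supplies `H₂`. -/
theorem chiOn_few_inN_lt (h₁ : G.ForcesCopy H₁ c) (h₂ : G.ForcesCopy H₂ c)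
    (hh : Nat.card H₁.V ≤ h) {A B : Set G.V} (hAB : G.Linked H₁ H₂ A B) {t : ℕ}
    (hB : c + h * t ≤ G.chiOn B) : G.chiOn {a ∈ A | G.chiOn (G.inN a ∩ B) < t} < c := by
  by_contra! hbad
  obtain ⟨g, hg, hgA⟩ := h₁ _ hbad
  have hU : G.chiOn (⋃ y, G.inN (g y) ∩ B) ≤ h * t :=
    (chiOn_iUnion_le _ t fun y => (hgA y).2.le).trans (Nat.mul_le_mul_right _ hh)
  have := chiOn_le_add_diff B (⋃ y, G.inN (g y) ∩ B)
  obtain ⟨f, hf, hfB⟩ := h₂ (B \ ⋃ y, G.inN (g y) ∩ B) (by omega)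
  obtain ⟨y, x, hxy⟩ := hAB.left g f hg hf (fun x => (hgA x).1) (fun y => (hfB y).1)
  refine hxy (adj_of_not_adj ?_ fun hadj => (hfB x).2 (Set.mem_iUnion.2 ⟨y, hadj, (hfB x).1⟩))
  exact (hAB.disjoint.ne_of_mem (hgA y).1 (hfB x).1).symm

/-- A set of large chromatic number contains a vertex splitting each of `k` given sets linked to
it into two parts of large chromatic number. -/
theorem exists_splitting_vertex (h₁ : G.ForcesCopy H₁ c) (h₂ : G.ForcesCopy H₂ c)
    (hh₁ : Nat.card H₁.V ≤ h) (hh₂ : Nat.card H₂.V ≤ h) {k t : ℕ} {A : Set G.V}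
    {B : Fin k → Set G.V} (hAB : ∀ i, G.Linked H₁ H₂ A (B i))
    (hB : ∀ i, c + h * t ≤ G.chiOn (B i)) (hA : k * (2 * c) < G.chiOn A) :
    ∃ a ∈ A, ∀ i, t ≤ G.chiOn (G.outN a ∩ B i) ∧ t ≤ G.chiOn (G.inN a ∩ B i) := by
  by_contra! hno
  -- With no splitting vertex, `A` is covered by `2 * k` exceptional sets, each of chromatic number
  -- below `c`.
  refine hA.not_ge ((chiOn_mono (fun a ha => ?_)).trans ((chiOn_iUnion_le
    (fun i => {a ∈ A | G.chiOn (G.outN a ∩ B i) < t} ∪ {a ∈ A | G.chiOn (G.inN a ∩ B i) < t})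
    (2 * c) fun i => ?_).trans (by simp)))
  · obtain ⟨i, hi⟩ := hno a ha
    refine Set.mem_iUnion.2 ⟨i, ?_⟩
    by_cases hout : t ≤ G.chiOn (G.outN a ∩ B i)
    · exact Or.inr ⟨ha, hi hout⟩
    · exact Or.inl ⟨ha, not_le.1 hout⟩
  · refine (chiOn_union_le _ _).trans ?_
    have := chiOn_few_outN_lt h₁ h₂ hh₂ (hAB i) (hB i)
    have := chiOn_few_inN_lt h₁ h₂ hh₁ (hAB i) (hB i)
    omega

/-- Pairwise linked sets of large chromatic number have a transversal inducing any prescribed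
tournament. -/
theorem exists_transversal (H₁ H₂ : Tournament.{u}) (c h : ℕ) (hh₁ : Nat.card H₁.V ≤ h)
    (hh₂ : Nat.card H₂.V ≤ h) (k : ℕ) :
    ∃ N : ℕ, ∀ G : Tournament.{u}, G.ForcesCopy H₁ c → G.ForcesCopy H₂ c →
      ∀ (K : Fin k → Fin k → Prop) (B : Fin k → Set G.V),
        (∀ i j, i < j → G.Linked H₁ H₂ (B i) (B j)) → (∀ i, N ≤ G.chiOn (B i)) →
        ∃ x : Fin k → G.V, (∀ i, x i ∈ B i) ∧ ∀ i j, i < j →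
          (K i j → G.Adj (x i) (x j)) ∧ (¬ K i j → G.Adj (x j) (x i)) := by
  classical
  induction k with
  | zero => exact ⟨0, fun G _ _ K B _ _ => ⟨fun i => i.elim0, fun i => i.elim0, fun i => i.elim0⟩⟩
  | succ k ih =>
    obtain ⟨N, hN⟩ := ih
    -- The term `c + h * N` leaves `N` on either side of each later set after splitting; `k * (2 *
    -- c) + 1` provides the splitting vertex in `B 0`.
    refine ⟨c + h * N + k * (2 * c) + 1, fun G h₁ h₂ K B hB hχ => ?_⟩
    obtain ⟨a, ha, haB⟩ := exists_splitting_vertex h₁ h₂ hh₁ hh₂ (t := N) (A := B 0)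
      (B := fun i : Fin k => B i.succ) (fun i => hB _ _ (Fin.succ_pos i))
      (fun i => by have := hχ i.succ; omega) (by have := hχ 0; omega)
    let B' : Fin k → Set G.V := fun i =>
      (if K 0 i.succ then G.outN a else G.inN a) ∩ B i.succ
    obtain ⟨x, hxB, hx⟩ := hN G h₁ h₂ (fun i j => K i.succ j.succ) B'
      (fun i j hij => (hB _ _ (Fin.succ_lt_succ_iff.2 hij)).mono Set.inter_subset_right
        Set.inter_subset_right)
      (fun i => by
        dsimp only [B']
        split
        · exact (haB i).1
        · exact (haB i).2)
    refine ⟨Fin.cons a x, fun i => ?_, fun i j => ?_⟩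
    · refine Fin.cases ha (fun i => ?_) i
      simpa using (hxB i).2
    · refine Fin.cases (fun hij => absurd hij (Fin.not_lt_zero i)) (fun j => ?_) j
      refine Fin.cases (fun _ => ?_) (fun i hij => ?_) i
      · have hj := (hxB j).1
        simp only [Fin.cons_zero, Fin.cons_succ]
        exact ⟨fun hK => by rwa [if_pos hK] at hj, fun hK => by rwa [if_neg hK] at hj⟩
      · simpa using hx i j (Fin.succ_lt_succ_iff.1 hij)

/-- If `P` and `Q` are linked and have large chromatic number, then `P` includes two linked sets
of large chromatic number. -/
theorem exists_linked_pair (hfree : G.Free (delta H₁ H₂ one)) (h₁ : G.ForcesCopy H₁ c)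
    (h₂ : G.ForcesCopy H₂ c) (hh₁ : Nat.card H₁.V ≤ h) (hh₂ : Nat.card H₂.V ≤ h) {t : ℕ}
    {P Q : Set G.V} (hPQ : G.Linked H₁ H₂ P Q) (hP : c + h * (c + h * t) ≤ G.chiOn P)
    (hQ : 4 * c < G.chiOn Q) :
    ∃ P₁ P₂, P₁ ⊆ P ∧ P₂ ⊆ P ∧ G.Linked H₁ H₂ P₁ P₂ ∧ t ≤ G.chiOn P₁ ∧ t ≤ G.chiOn P₂ := by
  -- The vertex `q` only forbids arrows from its out-side to its in-side. A second vertex `q'`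
  -- splits both sides, and taking opposite halves forbids the other direction.
  obtain ⟨q, -, hq⟩ := exists_splitting_vertex h₁ h₂ hh₁ hh₂ (B := fun _ : Fin 1 => P)
    (fun _ => hPQ.symm) (fun _ => hP) (by omega)
  obtain ⟨q', -, hq'⟩ := exists_splitting_vertex h₁ h₂ hh₁ hh₂ (A := Q) (t := t)
    (B := ![G.outN q ∩ P, G.inN q ∩ P])
    (fun i => by
      fin_cases i
      · exact hPQ.symm.mono le_rfl Set.inter_subset_right
      · exact hPQ.symm.mono le_rfl Set.inter_subset_right)
    (fun i => by
      fin_cases i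
      · exact (hq 0).1
      · exact (hq 0).2)
    (by omega)
  refine ⟨G.inN q' ∩ (G.outN q ∩ P), G.outN q' ∩ (G.inN q ∩ P), fun x hx => hx.2.2,
    fun x hx => hx.2.2, ⟨?_, ?_, ?_⟩, (hq' 0).2, (hq' 1).1⟩
  · exact (disjoint_outN_inN q).mono (fun x hx => hx.2.1) (fun x hx => hx.2.1)
  · exact hfree.noArrow q (fun x hx => hx.2.1) (fun x hx => hx.2.1)
  · exact hfree.noArrow q' (fun x hx => hx.1) (fun x hx => hx.1)

/-- Split off one half of a linked pair inside `P` and continue in the other half, which is still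
linked to the same `Q`. -/
theorem exists_pairwise_linked (H₁ H₂ : Tournament.{u}) (c h : ℕ) (hh₁ : Nat.card H₁.V ≤ h)
    (hh₂ : Nat.card H₂.V ≤ h) (t k : ℕ) :
    ∃ N : ℕ, ∀ G : Tournament.{u}, G.Free (delta H₁ H₂ one) → G.ForcesCopy H₁ c →
      G.ForcesCopy H₂ c → ∀ P Q : Set G.V, G.Linked H₁ H₂ P Q → N ≤ G.chiOn P → N ≤ G.chiOn Q →
        ∃ B : Fin k → Set G.V, (∀ i, B i ⊆ P) ∧ (∀ i j, i < j → G.Linked H₁ H₂ (B i) (B j)) ∧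
          ∀ i, t ≤ G.chiOn (B i) := by
  induction k with
  | zero =>
    exact ⟨0, fun G _ _ _ P Q _ _ _ => ⟨fun i => i.elim0, fun i => i.elim0, fun i => i.elim0,
      fun i => i.elim0⟩⟩
  | succ k ih =>
    obtain ⟨N, hN⟩ := ih
    refine ⟨c + h * (c + h * (t + N)) + 4 * c + 1 + N,
      fun G hfree h₁ h₂ P Q hPQ hP hQ => ?_⟩
    -- Asking for `t + N` serves both halves: `P₁` needs `t`, and `P₂` needs `N` for the induction.
    obtain ⟨P₁, P₂, hP₁, hP₂, hlink, ht₁, ht₂⟩ := exists_linked_pair hfree h₁ h₂ hh₁ hh₂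
      (t := t + N) hPQ (by omega) (by omega)
    obtain ⟨B, hBP, hBB, hBt⟩ := hN G hfree h₁ h₂ P₂ Q (hPQ.mono hP₂ le_rfl) (by omega) (by omega)
    refine ⟨Fin.cons P₁ B, fun i => ?_, fun i j => ?_, fun i => ?_⟩
    · refine Fin.cases hP₁ (fun i => ?_) i
      simpa using (hBP i).trans hP₂
    · refine Fin.cases (fun hij => absurd hij (Fin.not_lt_zero i)) (fun j => ?_) j
      refine Fin.cases (fun _ => ?_) (fun i hij => ?_) i
      · simpa using hlink.mono le_rfl (hBP j)
      · simpa using hBB i j (Fin.succ_lt_succ_iff.1 hij)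
    · refine Fin.cases ?_ (fun i => ?_) i
      · simp only [Fin.cons_zero]; omega
      · simpa using hBt i

theorem isCopy_of_lt {k : ℕ} (e : H.V ≃ Fin k) (x : Fin k → G.V)
    (hx : ∀ i j, i < j → (H.Adj (e.symm i) (e.symm j) → G.Adj (x i) (x j)) ∧
      (¬ H.Adj (e.symm i) (e.symm j) → G.Adj (x j) (x i))) :
    G.IsCopy H (fun v => x (e v)) := by
  intro v w
  rcases lt_trichotomy (e v) (e w) with hlt | heq | hlt
  · have := hx _ _ hlt
    simp only [Equiv.symm_apply_apply] at this
    exact ⟨fun h => by_contra fun h' => G.asymm _ _ h (this.2 h'), this.1⟩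
  · obtain rfl := e.injective heq
    exact iff_of_false (G.loopless _) (H.loopless _)
  · have := hx _ _ hlt
    simp only [Equiv.symm_apply_apply] at this
    refine ⟨fun h => ?_, fun h => this.2 (H.asymm _ _ h)⟩
    refine adj_of_not_adj (fun heq => ?_) fun h' => G.asymm _ _ h (this.1 h')
    exact hlt.ne (congrArg e heq)

/-- In a tournament without `Δ(H₁, H₂, 1)` in which both `H₁` and `H₂` are forced, one of any two
linked sets has bounded chromatic number. -/
theorem exists_linked_bound (H₁ H₂ : Tournament.{u}) (c : ℕ) :
    ∃ N : ℕ, ∀ G : Tournament.{u}, G.Free (delta H₁ H₂ one) → G.ForcesCopy H₁ c →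
      G.ForcesCopy H₂ c → ∀ P Q : Set G.V, G.Linked H₁ H₂ P Q →
        min (G.chiOn P) (G.chiOn Q) ≤ N := by
  obtain ⟨k, ⟨e⟩⟩ := Finite.exists_equiv_fin (delta H₁ H₂ one).V
  obtain ⟨t, ht⟩ := exists_transversal H₁ H₂ c (Nat.card H₁.V + Nat.card H₂.V)
    (Nat.le_add_right _ _) (Nat.le_add_left _ _) k
  obtain ⟨N, hN⟩ := exists_pairwise_linked H₁ H₂ c (Nat.card H₁.V + Nat.card H₂.V)
    (Nat.le_add_right _ _) (Nat.le_add_left _ _) t k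
  refine ⟨N, fun G hfree h₁ h₂ P Q hPQ => ?_⟩
  by_contra! hlt
  obtain ⟨B, -, hB, hBt⟩ := hN G hfree h₁ h₂ P Q hPQ (hlt.le.trans (min_le_left _ _))
    (hlt.le.trans (min_le_right _ _))
  obtain ⟨x, -, hx⟩ := ht G h₁ h₂ (fun i j => (delta H₁ H₂ one).Adj (e.symm i) (e.symm j)) B hB hBt
  exact hfree (isCopy_of_lt e x hx).contains

/-! ### Diamonds as linked pairs -/

theorem Complete.adj {A B : Set G.V} (hAB : G.Complete A B) {x y : G.V} (hx : x ∈ A) (hy : y ∈ B) :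
    G.Adj x y :=
  adj_of_not_adj (hAB.1.ne_of_mem hx hy).symm (hAB.2 y hy x hx)

/-- The apex `a` excludes arrows from `P` to `Q`, and `b` those from `Q` to `P`. -/
theorem IsDiamond.linked (hfree : G.Free (delta H₁ H₂ one)) {a b : G.V} {P Q : Set G.V}
    (hd : G.IsDiamond a b P Q) : G.Linked H₁ H₂ P Q where
  disjoint := hd.disjoint
  left := hfree.noArrow a (fun _ hx => hd.a_P.adj rfl hx) (fun _ hx => hd.Q_a.adj hx rfl)
  right := hfree.noArrow b (fun _ hx => hd.b_Q.adj rfl hx) (fun _ hx => hd.P_b.adj hx rfl)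

end Tournament
namespace Tournament

variable {G : Tournament.{u}}

/-! ### Domination -/

/-- `D` is a subset of `U`, and every vertex of `U` outside `D` has an in-neighbour in `D`. -/
def Dominates (G : Tournament.{u}) (D : Finset G.V) (U : Set G.V) : Prop :=
  (∀ w ∈ D, w ∈ U) ∧ ∀ v ∈ U, v ∈ D ∨ ∃ w ∈ D, G.Adj w v

theorem exists_dominates_minimum (U : Set G.V) :
    ∃ D, G.Dominates D U ∧ ∀ D', G.Dominates D' U → D.card ≤ D'.card := by
  classical
  have hex : ∃ n, ∃ D, G.Dominates D U ∧ D.card = n :=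
    ⟨_, U.toFinite.toFinset, ⟨fun w hw => by simpa using hw, fun v hv => Or.inl (by simpa using hv)⟩,
      rfl⟩
  obtain ⟨D, hD, hcard⟩ := Nat.find_spec hex
  exact ⟨D, hD, fun D' hD' => hcard ▸ Nat.find_min' hex ⟨D', hD', rfl⟩⟩

theorem not_isAcyclic_of_triangle {A : Set G.V} {x y z : G.V} (hx : x ∈ A) (hy : y ∈ A)
    (hz : z ∈ A) (hxy : G.Adj x y) (hyz : G.Adj y z) (hzx : G.Adj z x) :
    ¬ (G.induce A).IsAcyclic := fun h =>
  h ⟨x, hx⟩ <|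
    ((Relation.TransGen.single (r := (G.induce A).Adj) (a := ⟨x, hx⟩) (b := ⟨y, hy⟩) hxy).tail
      (show (G.induce A).Adj ⟨y, hy⟩ ⟨z, hz⟩ from hyz)).tail
      (show (G.induce A).Adj ⟨z, hz⟩ ⟨x, hx⟩ from hzx)

/-- A set that is coloured with `k` acyclic classes and has chromatic number at least `k` meets
every class. -/
theorem exists_mem_class {k : ℕ} {B : Fin k → Set G.V} (hB : ∀ i, (G.induce (B i)).IsAcyclic)
    {S : Set G.V} (hS : S ⊆ ⋃ i, B i) (hk : k ≤ G.chiOn S) (i : Fin k) : ∃ x ∈ S, x ∈ B i := by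
  by_contra! hno
  obtain ⟨n, rfl⟩ : ∃ n, k = n + 1 := ⟨k - 1, by have := i.2; omega⟩
  have : G.ColourableOn S n := by
    refine ⟨fun j => B (i.succAbove j), fun j => hB _, fun x hx => ?_⟩
    obtain ⟨l, hl⟩ := Set.mem_iUnion.1 (hS hx)
    have hli : l ≠ i := by rintro rfl; exact hno x hx hl
    obtain ⟨j, rfl⟩ := Fin.exists_succAbove_eq hli
    exact Set.mem_iUnion.2 ⟨j, hl⟩
  have := chiOn_le_iff.2 this
  omega

/-- Gluing step: in any `k`-colouring of the union of `A`, `W` and the sets `Z S`, the largest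
colour class on `W` gives a monochromatic cyclic triangle. -/
theorem lt_chiOn_of_triangles {k m : ℕ} {A W T : Set G.V} {Wf : Finset G.V} (hW : W = ↑Wf)
    (hWm : k * m < Wf.card) (Z : Finset G.V → Set G.V)
    (hAT : A ⊆ T) (hWT : W ⊆ T) (hA : k ≤ G.chiOn A)
    (hZT : ∀ S ⊆ Wf, m < S.card → Z S ⊆ T)
    (hZ : ∀ S ⊆ Wf, m < S.card → k ≤ G.chiOn (Z S))
    (hAW : ∀ a ∈ A, ∀ w ∈ W, G.Adj a w)
    (hZA : ∀ S ⊆ Wf, m < S.card → ∀ z ∈ Z S, ∀ a ∈ A, G.Adj z a)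
    (hWZ : ∀ S ⊆ Wf, m < S.card → ∀ z ∈ Z S, ∃ w ∈ S, G.Adj w z) : k < G.chiOn T := by
  classical
  by_contra! hT
  obtain ⟨B, hB, hTB⟩ := chiOn_le_iff.1 hT
  -- The value `none` is a default off `W`, since `T` need not cover every vertex.
  have hcol : ∀ w : G.V, ∃ i : Option (Fin k), w ∈ W → ∃ j, i = some j ∧ w ∈ B j := by
    intro w
    by_cases hw : w ∈ W
    · obtain ⟨j, hj⟩ := Set.mem_iUnion.1 (hTB (hWT hw))
      exact ⟨some j, fun _ => ⟨j, rfl, hj⟩⟩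
    · exact ⟨none, fun h => absurd h hw⟩
  choose f hf using hcol
  obtain ⟨i, -, hi⟩ := Finset.exists_lt_card_fiber_of_mul_lt_card_of_maps_to
    (s := Wf) (t := Finset.univ.map Function.Embedding.some) (f := f) (n := m)
    (fun w hw => by
      obtain ⟨j, hj, -⟩ := hf w (hW ▸ hw)
      simp [hj]) (by simpa using hWm)
  set S := Wf.filter fun w => f w = i with hS
  have hSW : S ⊆ Wf := Finset.filter_subset _ _
  obtain ⟨w₀, hw₀⟩ := Finset.card_pos.1 ((Nat.zero_le m).trans_lt hi)
  obtain ⟨j, hj, -⟩ := hf w₀ (hW ▸ hSW hw₀)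
  have hij : i = some j := by rw [← hj]; exact (Finset.mem_filter.1 hw₀).2.symm
  -- Both `Z S` and `A` use every colour, so there are `z` and `a` of the colour of `S`; the
  -- triangle is `z → a → w → z`.
  obtain ⟨z, hzZ, hzB⟩ := exists_mem_class hB ((hZT S hSW hi).trans hTB) (hZ S hSW hi) j
  obtain ⟨a, haA, haB⟩ := exists_mem_class hB (hAT.trans hTB) hA j
  obtain ⟨w, hwS, hwz⟩ := hWZ S hSW hi z hzZ
  have hwW : w ∈ W := hW ▸ hSW hwS
  obtain ⟨j', hj', hwB⟩ := hf w hwW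
  have : j' = j := by
    have := (Finset.mem_filter.1 hwS).2
    rw [hj', hij] at this
    exact Option.some.inj this
  subst this
  exact not_isAcyclic_of_triangle hzB haB hwB (hZA S hSW hi z hzZ a haA) (hAW a haA w hwW) hwz
    (hB _)

/-- A vertex set with large domination number includes a set of bounded size and large chromatic
number. -/
theorem exists_small_chiOn_of_domination (k : ℕ) :
    ∃ K l : ℕ, ∀ (G : Tournament.{u}) (U : Set G.V), (∀ D, G.Dominates D U → K < D.card) →
      ∃ S : Finset G.V, (∀ x ∈ S, x ∈ U) ∧ S.card ≤ l ∧ k ≤ G.chiOn (S : Set G.V) := by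
  classical
  induction k with
  | zero => exact ⟨0, 0, fun G U _ => ⟨∅, by simp, by simp, Nat.zero_le _⟩⟩
  | succ k ih =>
    obtain ⟨K, l, hKl⟩ := ih
    -- The general step needs `A` nonempty, hence `0 < k`.
    rcases Nat.eq_zero_or_pos k with rfl | hk
    · refine ⟨0, 1, fun G U hU => ?_⟩
      have hne : U.Nonempty := by
        rw [Set.nonempty_iff_ne_empty]
        rintro rfl
        exact absurd (hU ∅ ⟨by simp, by simp⟩) (by simp)
      obtain ⟨v, hv⟩ := hne
      exact ⟨{v}, by simpa using hv, by simp, chiOn_pos_of_nonempty (by simp)⟩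
    -- A subset of `D` with more than `m` elements is too big to be exchanged for a set of size `l`
    -- plus one of size `K`. With `M = k * m + 1`, some colour occurs on more than `m` vertices of
    -- `W`.
    set m := l + K
    set M := k * m + 1
    refine ⟨M + K, M + l + 2 ^ M * l, fun G U hU => ?_⟩
    obtain ⟨D, hD, hmin⟩ := G.exists_dominates_minimum U
    obtain ⟨W, hWD, hWM⟩ := Finset.exists_subset_card_eq
      (show M ≤ D.card from ((Nat.le_add_right _ _).trans_lt (hU D hD)).le)
    have hWU : ∀ w ∈ W, w ∈ U := fun w hw => hD.1 w (hWD hw)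
    -- If at most `K` vertices dominated what `W` misses, adding `W` would dominate `U` with at most
    -- `M + K` vertices.
    obtain ⟨A, hAU, hAl, hAk⟩ := hKl G {u ∈ U | u ∉ W ∧ ∀ w ∈ W, ¬ G.Adj w u} (fun E hE => by
      by_contra! hEK
      have hdom : G.Dominates (W ∪ E) U := by
        refine ⟨fun w hw => ?_, fun v hv => ?_⟩
        · rcases Finset.mem_union.1 hw with hw | hw
          · exact hWU w hw
          · exact (hE.1 w hw).1
        · by_cases hv' : v ∉ W ∧ ∀ w ∈ W, ¬ G.Adj w v
          · rcases hE.2 v ⟨hv, hv'⟩ with h | ⟨w, hw, h⟩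
            · exact Or.inl (Finset.mem_union_right _ h)
            · exact Or.inr ⟨w, Finset.mem_union_right _ hw, h⟩
          · by_cases hvW : v ∈ W
            · exact Or.inl (Finset.mem_union_left _ hvW)
            · push Not at hv'
              obtain ⟨w, hw, h⟩ := hv' hvW
              exact Or.inr ⟨w, Finset.mem_union_left _ hw, h⟩
      have := hU _ hdom
      have := Finset.card_union_le W E
      omega)
    have hAW : ∀ a ∈ A, ∀ w ∈ W, G.Adj a w := fun a ha w hw => by
      refine adj_of_not_adj ?_ ((hAU a ha).2.2 w hw)
      rintro rfl
      exact (hAU _ ha).2.1 hw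
    obtain ⟨a₀, ha₀⟩ := nonempty_of_chiOn_pos (hk.trans_le hAk)
    have hZ : ∀ S : Finset G.V, ∃ Z : Finset G.V, Z.card ≤ l ∧ (S ⊆ W → m < S.card →
        (∀ z ∈ Z, z ∈ U) ∧ k ≤ G.chiOn (Z : Set G.V) ∧ (∀ z ∈ Z, ∀ a ∈ A, G.Adj z a) ∧
          ∀ z ∈ Z, ∃ w ∈ S, G.Adj w z) := by
      intro S
      by_cases hS : S ⊆ W ∧ m < S.card
      swap
      · exact ⟨∅, by simp, fun h h' => absurd ⟨h, h'⟩ hS⟩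
      obtain ⟨hSW, hSm⟩ := hS
      -- If at most `K` vertices dominated this set, replacing `S` by them and `A` would give a
      -- dominating set smaller than the minimum `D`.
      obtain ⟨Z, hZU, hZl, hZk⟩ := hKl G
        {u ∈ U | u ∉ A ∧ (∀ a ∈ A, ¬ G.Adj a u) ∧ ∃ w ∈ S, G.Adj w u} (fun E hE => by
        by_contra! hEK
        have hdom : G.Dominates ((D \ S) ∪ A ∪ E) U := by
          refine ⟨fun w hw => ?_, fun v hv => ?_⟩
          · rcases Finset.mem_union.1 hw with hw | hw
            · rcases Finset.mem_union.1 hw with hw | hw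
              · exact hD.1 w (Finset.mem_sdiff.1 hw).1
              · exact (hAU w hw).1
            · exact (hE.1 w hw).1
          · by_cases hvA : v ∈ A
            · exact Or.inl (by simp [hvA])
            by_cases hvA' : ∃ a ∈ A, G.Adj a v
            · obtain ⟨a, ha, h⟩ := hvA'
              exact Or.inr ⟨a, by simp [ha], h⟩
            by_cases hvS : ∃ w ∈ S, G.Adj w v
            · push Not at hvA'
              rcases hE.2 v ⟨hv, hvA, hvA', hvS⟩ with h | ⟨w, hw, h⟩
              · exact Or.inl (by simp [h])
              · exact Or.inr ⟨w, by simp [hw], h⟩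
            -- The removed vertices of `S` are themselves dominated by `A`.
            have hvS' : v ∉ S := fun h => hvA' ⟨a₀, ha₀, hAW _ ha₀ _ (hSW h)⟩
            rcases hD.2 v hv with h | ⟨w, hw, h⟩
            · exact Or.inl (by simp [h, hvS'])
            · have hwS : w ∉ S := fun h' => hvS ⟨w, h', h⟩
              exact Or.inr ⟨w, by simp [hw, hwS], h⟩
        have h1 := hmin _ hdom
        have h2 := Finset.card_union_le ((D \ S) ∪ A) E
        have h3 := Finset.card_union_le (D \ S) A
        have h4 := Finset.card_sdiff_add_card_eq_card (hSW.trans hWD)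
        omega)
      refine ⟨Z, hZl, fun _ _ => ⟨fun z hz => (hZU z hz).1, hZk, fun z hz a ha => ?_,
        fun z hz => (hZU z hz).2.2.2⟩⟩
      refine adj_of_not_adj ?_ ((hZU z hz).2.2.1 a ha)
      rintro rfl
      exact (hZU _ hz).2.1 ha
    choose Z hZl hZ using hZ
    set P := W.powerset.filter fun S => m < S.card
    have hmem : ∀ S ∈ P, S ⊆ W ∧ m < S.card := fun S hS =>
      ⟨Finset.mem_powerset.1 (Finset.mem_filter.1 hS).1, (Finset.mem_filter.1 hS).2⟩
    have hmem' : ∀ S ⊆ W, m < S.card → S ∈ P := fun S h h' =>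
      Finset.mem_filter.2 ⟨Finset.mem_powerset.2 h, h'⟩
    refine ⟨W ∪ A ∪ P.biUnion Z, fun x hx => ?_, ?_, ?_⟩
    · rcases Finset.mem_union.1 hx with hx | hx
      · rcases Finset.mem_union.1 hx with hx | hx
        · exact hWU x hx
        · exact (hAU x hx).1
      · obtain ⟨S, hS, hxS⟩ := Finset.mem_biUnion.1 hx
        exact (hZ S (hmem S hS).1 (hmem S hS).2).1 x hxS
    · have h1 := Finset.card_union_le (W ∪ A) (P.biUnion Z)
      have h2 := Finset.card_union_le W A
      have h3 := Finset.card_biUnion_le_card_mul P Z l fun S _ => hZl S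
      have h4 : P.card ≤ 2 ^ M := by
        rw [← hWM, ← Finset.card_powerset]
        exact Finset.card_filter_le _ _
      have h5 := Nat.mul_le_mul_right l h4
      omega
    · refine lt_chiOn_of_triangles (A := (A : Set G.V)) (W := (W : Set G.V)) rfl
        (m := m) (by omega) (fun S => (Z S : Set G.V)) (fun x hx => ?_) (fun x hx => ?_) hAk
        (fun S h h' x hx => ?_) (fun S h h' => (hZ S h h').2.1) hAW
        (fun S h h' => (hZ S h h').2.2.1) (fun S h h' => (hZ S h h').2.2.2)
      · have : x ∈ A := hx
        simp [this]
      · have : x ∈ W := hx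
        simp [this]
      · exact Finset.mem_union_right _ (Finset.mem_biUnion.2 ⟨S, hmem' S h h', hx⟩)

/-! ### From local to global chromatic bounds -/

theorem Dominates.chiOn_le {D : Finset G.V} {U : Set G.V} (hD : G.Dominates D U) {t : ℕ}
    (hU : ∀ u ∈ U, G.chiOn (G.outN u ∩ U) ≤ t) : G.chiOn U ≤ D.card * (t + 1) := by
  refine (chiOn_mono fun v hv => ?_).trans (chiOn_biUnion_finset_le D
    (fun w => (G.outN w ∩ U) ∪ {w}) (t + 1) fun w hw => ?_)
  · rcases hD.2 v hv with h | ⟨w, hw, h⟩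
    · exact Set.mem_biUnion h (Or.inr rfl)
    · exact Set.mem_biUnion hw (Or.inl ⟨h, hv⟩)
  · exact (chiOn_union_le _ _).trans
      (add_le_add (hU w (hD.1 w hw)) (chiOn_singleton_le w))

/-- Local to global: if all out-neighbourhoods inside a vertex set have bounded chromatic number,
then so does the set. -/
theorem exists_chiOn_le_of_outN (t : ℕ) :
    ∃ N : ℕ, ∀ (G : Tournament.{u}) (U : Set G.V),
      (∀ u ∈ U, G.chiOn (G.outN u ∩ U) ≤ t) → G.chiOn U ≤ N := by
  obtain ⟨K, l, hKl⟩ := exists_small_chiOn_of_domination.{u} (t + 1)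
  -- The extra `l` ensures that, when no dominating set has size at most `K + l`, the small set `S`
  -- does not dominate. A vertex missed by `S` has all of `S` in its out-neighbourhood,
  -- contradicting `t < χ(S)`.
  refine ⟨(K + l) * (t + 1), fun G U hU => ?_⟩
  obtain ⟨D, hD, hcard⟩ : ∃ D, G.Dominates D U ∧ D.card ≤ K + l := by
    by_contra! hno
    obtain ⟨S, hSU, hSl, hSt⟩ := hKl G U fun D hD => (Nat.le_add_right K l).trans_lt (hno D hD)
    refine absurd (hno S ⟨hSU, fun v hv => ?_⟩) (by omega)
    by_contra! hv'
    have : G.chiOn (S : Set G.V) ≤ t := (chiOn_mono (B := G.outN v ∩ U) fun x hx =>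
      ⟨adj_of_not_adj (fun h => hv'.1 (h ▸ hx)) (hv'.2 x hx), hSU x hx⟩).trans (hU v hv)
    omega
  exact (hD.chiOn_le hU).trans (Nat.mul_le_mul_right _ hcard)

/-- The tournament with all edges reversed. -/
def reverse (G : Tournament.{u}) : Tournament.{u} where
  V := G.V
  finite := G.finite
  Adj x y := G.Adj y x
  loopless := G.loopless
  asymm x y := G.asymm y x
  total x y h := G.total y x h.symm

theorem IsAcyclic.reverse (h : G.IsAcyclic) : G.reverse.IsAcyclic := fun x hx =>
  h x (Relation.transGen_swap.1 hx)

theorem chiOn_reverse_le (A : Set G.V) : G.chiOn A ≤ G.reverse.chiOn A := by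
  obtain ⟨B, hB, hA⟩ := colourableOn_chiOn (G := G.reverse) A
  exact chiOn_le_iff.2 ⟨B, fun i => (hB i).reverse, hA⟩

theorem exists_chiOn_le_of_inN (t : ℕ) :
    ∃ N : ℕ, ∀ (G : Tournament.{u}) (U : Set G.V),
      (∀ u ∈ U, G.chiOn (G.inN u ∩ U) ≤ t) → G.chiOn U ≤ N := by
  obtain ⟨N, hN⟩ := exists_chiOn_le_of_outN.{u} t
  refine ⟨N, fun G U hU => (chiOn_reverse_le U).trans (hN G.reverse U fun u hu => ?_)⟩
  exact (chiOn_reverse_le (G := G.reverse) _).trans (hU u hu)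

end Tournament
namespace Tournament

variable {G : Tournament.{u}}

/-! ### Numberings -/

/-- The chromatic number of the set of out-neighbours of `b` that are not out-neighbours
of `a`. -/
noncomputable def outDist (G : Tournament.{u}) (a b : G.V) : ℕ := G.chiOn (G.outN b \ G.outN a)

theorem outDist_triangle (a b c : G.V) : G.outDist a c ≤ G.outDist a b + G.outDist b c := by
  refine (chiOn_mono (fun x hx => ?_)).trans (chiOn_union_le _ _)
  by_cases hb : x ∈ G.outN b
  · exact Or.inl ⟨hb, hx.2⟩
  · exact Or.inr ⟨hx.1, hb⟩

theorem isDiamond_outN_inter_inN {a b : G.V} (hne : a ≠ b) :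
    G.IsDiamond a b (G.outN a ∩ G.inN b) (G.outN b ∩ G.inN a) where
  ne := hne
  disjoint := (disjoint_outN_inN a).mono Set.inter_subset_left Set.inter_subset_right
  left_subset := by
    rintro x ⟨h, h'⟩
    refine ⟨trivial, ?_⟩
    rintro (rfl | rfl)
    · exact G.loopless _ h
    · exact G.loopless _ h'
  right_subset := by
    rintro x ⟨h, h'⟩
    refine ⟨trivial, ?_⟩
    rintro (rfl | rfl)
    · exact G.loopless _ h'
    · exact G.loopless _ h
  a_P := ⟨Set.disjoint_singleton_left.2 fun h => G.loopless _ h.1,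
    by rintro x hx y rfl; exact G.asymm _ _ hx.1⟩
  P_b := ⟨Set.disjoint_singleton_right.2 fun h => G.loopless _ h.2,
    by rintro x rfl y hy; exact G.asymm _ _ hy.2⟩
  b_Q := ⟨Set.disjoint_singleton_left.2 fun h => G.loopless _ h.1,
    by rintro x hx y rfl; exact G.asymm _ _ hx.1⟩
  Q_a := ⟨Set.disjoint_singleton_right.2 fun h => G.loopless _ h.2,
    by rintro x rfl y hy; exact G.asymm _ _ hy.2⟩

/-- The `+ 1` pays for `a` itself, which may be an out-neighbour of `b`. -/
theorem outDist_le (a b : G.V) : G.outDist a b ≤ G.chiOn (G.outN b ∩ G.inN a) + 1 := by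
  refine (chiOn_mono (B := (G.outN b ∩ G.inN a) ∪ {a}) fun x hx => ?_).trans
    ((chiOn_union_le _ _).trans (Nat.add_le_add_left (chiOn_singleton_le a) _))
  by_cases hxa : x = a
  · exact Or.inr hxa
  · exact Or.inl ⟨hx.1, adj_of_not_adj (fun h => hxa h.symm) hx.2⟩

/-- If all diamonds of `G` have bounded chromatic number, then the vertices of `G` can be linearly
ordered such that `outDist a b` is bounded whenever `a` precedes `b`. -/
theorem exists_numbering_outDist_le {d : ℕ}
    (hd : ∀ (a b : G.V) (P Q : Set G.V), G.IsDiamond a b P Q → G.diamondChi a b P Q ≤ d) :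
    ∃ v : G.Numbering, ∀ i j, i < j → G.outDist (v i) (v j) ≤ 2 * (d + 1) := by
  have hmin : ∀ a b : G.V, d + 1 < G.outDist b a → G.outDist a b ≤ d + 1 := by
    intro a b hab
    have hne : a ≠ b := by
      rintro rfl
      simp [outDist, chiOn_empty] at hab
    have h1 := hd _ _ _ _ (isDiamond_outN_inter_inN hne)
    have h2 := G.outDist_le a b
    have h3 := G.outDist_le b a
    unfold diamondChi at h1
    omega
  let r : G.V → G.V → Prop := fun a b => 2 * (d + 1) < G.outDist b a
  -- The factor 2 in `r` makes the bound survive along chains: from `outDist a x ≤ d + 1` and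
  -- `outDist y x > 2 * (d + 1)`, the triangle inequality gives `outDist y a > d + 1`, so `outDist a
  -- y ≤ d + 1` by `hmin`.
  have htrans : ∀ a b, Relation.TransGen r a b → G.outDist a b ≤ d + 1 := by
    intro a b hab
    induction hab with
    | single h => exact hmin _ _ (by have : 2 * (d + 1) < _ := h; omega)
    | @tail x y _ h ih =>
      have h : 2 * (d + 1) < G.outDist y x := h
      have := G.outDist_triangle y a x
      exact hmin _ _ (by omega)
  have hirr : ∀ a b, r a b → ¬ Relation.ReflTransGen r b a := by
    intro a b hab hba
    have h : 2 * (d + 1) < G.outDist b a := hab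
    rcases Relation.reflTransGen_iff_eq_or_transGen.1 hba with rfl | hba
    · simp [outDist, chiOn_empty] at h
    · have := htrans _ _ hba
      omega
  have : IsPartialOrder G.V (Relation.ReflTransGen r) :=
    { refl := fun a => Relation.ReflTransGen.refl
      trans := fun a b c => Relation.ReflTransGen.trans
      antisymm := fun a b hab hba => by
        rcases Relation.ReflTransGen.cases_head hab with h | ⟨x, hax, hxb⟩
        · exact h
        · exact absurd (hxb.trans hba) (hirr _ _ hax) }
  obtain ⟨s, hs, hrs⟩ := extend_partialOrder (Relation.ReflTransGen r)
  classical
  let : LinearOrder G.V :=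
    { le := s
      le_refl := hs.refl
      le_trans := hs.trans
      le_antisymm := hs.antisymm
      le_total := hs.total
      toDecidableLE := Classical.decRel _ }
  have := Fintype.ofFinite G.V
  let e := Fintype.orderIsoFinOfCardEq G.V (Nat.card_eq_fintype_card (α := G.V)).symm
  refine ⟨e.toEquiv, fun i j hij => ?_⟩
  by_contra! hlt
  have : e j ≤ e i := hrs _ _ (Relation.ReflTransGen.single hlt)
  exact absurd (e.le_iff_le.1 this) (not_le.2 hij)

/-- Bounded diamonds give numberings of bounded local chromatic number. -/
theorem exists_numbering_localChi_le (d : ℕ) :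
    ∃ c : ℕ, ∀ G : Tournament.{u},
      (∀ (a b : G.V) (P Q : Set G.V), G.IsDiamond a b P Q → G.diamondChi a b P Q ≤ d) →
        ∃ v : G.Numbering, G.localChi v ≤ c := by
  obtain ⟨N, hN⟩ := exists_chiOn_le_of_inN.{u} (2 * (d + 1))
  obtain ⟨N', hN'⟩ := exists_chiOn_le_of_outN.{u} (2 * (d + 1))
  refine ⟨N + N', fun G hd => ?_⟩
  obtain ⟨v, hv⟩ := exists_numbering_outDist_le hd
  refine ⟨v, Finset.sup_le fun i _ => ?_⟩
  refine (chiOn_mono (B := {x | ∃ j, x = v j ∧ G.IsBackwardOutNeighbour v i j} ∪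
    {x | ∃ j, x = v j ∧ G.IsForwardInNeighbour v i j}) ?_).trans
    ((chiOn_union_le _ _).trans (add_le_add (hN G _ ?_) (hN' G _ ?_)))
  · rintro x ⟨j, hx, h | h⟩
    · exact Or.inl ⟨j, hx, h⟩
    · exact Or.inr ⟨j, hx, h⟩
  -- In-neighbours of `v j` among the backward out-neighbours of `v i` lie in `N⁺(v i) \ N⁺(v j)`,
  -- where `j < i`.
  · rintro _ ⟨j, rfl, hj⟩
    refine (chiOn_mono ?_).trans (hv j i hj.1)
    rintro _ ⟨hadj, l, rfl, hl⟩
    exact ⟨hl.2, G.asymm _ _ hadj⟩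
  -- Out-neighbours of `v j` among the forward in-neighbours of `v i` lie in `N⁺(v j) \ N⁺(v i)`,
  -- where `i < j`.
  · rintro _ ⟨j, rfl, hj⟩
    refine (chiOn_mono ?_).trans (hv i j hj.1)
    rintro _ ⟨hadj, l, rfl, hl⟩
    exact ⟨hadj, G.asymm _ _ hl.2⟩

end Tournament

theorem mainTheorem7 (C : Set Tournament.{u}) (hC : Tournament.IsHereditary C)
    (H₁ H₂ : Tournament.{u}) (h₁ : H₁.IsHeroRelativeTo C) (h₂ : H₂.IsHeroRelativeTo C) :
    (∃ d : ℕ, ∀ G ∈ C, G.Free (Tournament.delta H₁ H₂ Tournament.one) →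
      ∀ (a b : G.V) (P Q : Set G.V), G.IsDiamond a b P Q → G.diamondChi a b P Q ≤ d) ∧
    (∃ c : ℕ, ∀ G ∈ C, G.Free (Tournament.delta H₁ H₂ Tournament.one) →
      ∃ v : G.Numbering, G.localChi v ≤ c) := by
  have hdiam : ∃ d : ℕ, ∀ G ∈ C, G.Free (Tournament.delta H₁ H₂ Tournament.one) →
      ∀ (a b : G.V) (P Q : Set G.V), G.IsDiamond a b P Q → G.diamondChi a b P Q ≤ d := by
    obtain ⟨c₁, hc₁⟩ := h₁
    obtain ⟨c₂, hc₂⟩ := h₂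
    obtain ⟨d, hd⟩ := Tournament.exists_linked_bound H₁ H₂ (max c₁ c₂)
    exact ⟨d, fun G hG hfree a b P Q hdia => hd G hfree
      ((hC.forcesCopy hc₁ hG).mono (le_max_left _ _))
      ((hC.forcesCopy hc₂ hG).mono (le_max_right _ _)) P Q (hdia.linked hfree)⟩
  refine ⟨hdiam, ?_⟩
  obtain ⟨d, hd⟩ := hdiam
  obtain ⟨c, hc⟩ := Tournament.exists_numbering_localChi_le.{u} d
  exact ⟨c, fun G hG hfree => hc G (hd G hG hfree)⟩
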